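/- Consider secondary transmitters in the plane in the frame in which the typical secondary receiver is the origin and its transmitter is $r_{\mathrm s}\angle 0$. Let $\alpha,\rho,\tau,p_{\mathrm s},r_{\mathrm s}>0$, let the primary transmitter be at $x_{\mathrm p}\angle\delta_{\mathrm p}$ and the primary receiver at $\mathbf Y_{\mathrm p}=x_{\mathrm p}\angle\delta_{\mathrm p}+r_{\mathrm p}\angle\omega_{\mathrm p}$. For $x>0$ and $\theta\in[0,2\pi)$ put $z_{\mathrm s}=\|x\angle\theta-\mathbf Y_{\mathrm p}\|$, $\beta_{\mathrm s}(x,\theta)=\angle(x\angle\theta-\mathbf Y_{\mathrm p})$ and $\delta_{\mathrm s}(x,\theta)=\theta-\beta_{\mathrm s}(x,\theta)$. All angles are taken modulo $2\pi$ with representatives in $(-\pi,\pi]$. The beam patterns of the secondary transmitters, the primary receiver and the secondary receiver are sectorized: for $jk\in\{\mathrm{st},\mathrm{pr},\mathrm{sr}\}$, $g_{jk}(\psi)=a_{jk}$ if $|\psi|\le\phi_{jk}/2$ (main lobe) and $g_{jk}(\psi)=b_{jk}$ otherwise (side lobe), where $a_{jk}>0$, $b_{jk}\ge 0$ and $0\le\phi_{jk}\le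 2\pi$. Let $\omega$ be uniform on $[0,2\pi)$, and let $$I=\int_0^{2\pi}\mathbb E_\omega\Big[\int_0^\infty\frac{1-e^{-A_{\mathrm s}z_{\mathrm s}^\alpha}}{1+C_{\mathrm s}x^\alpha}\,x\,\mathrm dx\Big]\mathrm d\theta,$$ $$A_{\mathrm s}=\frac{\rho}{p_{\mathrm s}\,g_{\mathrm{st}}(\beta_{\mathrm s}-\omega)\,g_{\mathrm{pr}}(\omega_{\mathrm p}-\beta_{\mathrm s})},\qquad C_{\mathrm s}=\frac{A_0}{\tau p_{\mathrm s}\,g_{\mathrm{st}}(\theta-\omega-\pi)\,g_{\mathrm{sr}}(\theta)},\qquad A_0=p_{\mathrm s}\,g_{\mathrm{sr}}(0)\,g_{\mathrm{st}}(0)\,r_{\mathrm s}^{-\alpha},$$ be the integral term (Term-4) of the secondary coverage probability. Integrals are taken in $[0,\infty]$, a quotient by a zero gain is $+\infty$, and $e^{-\infty}=1/\infty=0$. For $i=1,2,3,4$ let $(\mathcal A_i,\mathcal B_i)=(a_{\mathrm{st}},a_{\mathrm{st}}),(a_{\mathrm{st}},b_{\mathrm{st}}),(b_{\mathrm{st}},a_{\mathrm{st}}),(b_{\mathrm{st}},b_{\mathrm{st}})$,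 and let $q_i(\delta)$ be the probability that $-\omega$ and $\delta-\omega-\pi$ lie, respectively, in the lobes (main for $a_{\mathrm{st}}$, side for $b_{\mathrm{st}}$) of $g_{\mathrm{st}}$ named by $\mathcal A_i$ and $\mathcal B_i$. For $k=1,2,3,4$ let $(\mathcal C_k,\mathcal D_k)=(a_{\mathrm{pr}},a_{\mathrm{sr}}),(a_{\mathrm{pr}},b_{\mathrm{sr}}),(b_{\mathrm{pr}},a_{\mathrm{sr}}),(b_{\mathrm{pr}},b_{\mathrm{sr}})$ and let $\mathcal F_k=\mathcal F_k(x)\subseteq[0,2\pi)$ be $E_1\cap E_2$, $E_1\cap E_2^{\mathrm c}$, $E_1^{\mathrm c}\cap E_2$, $E_1^{\mathrm c}\cap E_2^{\mathrm c}$, where $E_1=\{\theta:\beta_{\mathrm s}(x,\theta)-\omega_{\mathrm p}\in(-\phi_{\mathrm{pr}}/2,\phi_{\mathrm{pr}}/2)\}$ and $E_2=\{\theta:\theta\in(-\phi_{\mathrm{sr}}/2,\phi_{\mathrm{sr}}/2)\}$. Then, for all angles $\beta,\theta$, the probability that $\beta-\omega$ and $\theta-\omega-\pi$ lie in the lobes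 named by $\mathcal A_i$ and $\mathcal B_i$ is $q_i(\theta-\beta)$, so it depends only on the relative angle; the integral $\int_0^{2\pi}\int_0^\infty\mathbb E_\omega\big[\tfrac{1-e^{-A_{\mathrm s}z_{\mathrm s}^\alpha}}{1+C_{\mathrm s}x^\alpha}\big]x\,\mathrm dx\,\mathrm d\theta$ equals $I$; and $$I=\int_0^\infty\sum_{k=1}^4\int_{\mathcal F_k}\sum_{i=1}^4 q_i(\delta_{\mathrm s}(x,\theta))\,\frac{1-\exp\!\Big(-\frac{\rho z_{\mathrm s}^\alpha}{p_{\mathrm s}\mathcal A_i\mathcal C_k}\Big)}{1+\frac1\tau\big(\frac{x}{r_{\mathrm s}}\big)^\alpha\frac{a_{\mathrm{st}}a_{\mathrm{sr}}}{\mathcal B_i\mathcal D_k}}\,x\,\mathrm d\theta\,\mathrm dx .$$ If $\alpha>2$, then $I<\infty$. -/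

import Mathlib

open MeasureTheory Set
open scoped ENNReal

noncomputable section

namespace CogCoverage

/-- The representative in `(-π, π]` of an angle given modulo `2π`. -/
def wrapAngle (ψ : ℝ) : ℝ := (ψ : Real.Angle).toReal

/-- The point `x∠θ` of the plane (identified with `ℂ`). -/
def polarPoint (x θ : ℝ) : ℂ := (x : ℂ) * Complex.exp ((θ : ℂ) * Complex.I)

/-- Parameters of a sectorized beam: main lobe gain, side lobe gain and beamwidth. -/
structure SectorBeam where
  a : ℝ
  b : ℝ
  width : ℝ
  a_pos : 0 < a
  b_nonneg : 0 ≤ b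
  width_nonneg : 0 ≤ width
  width_le : width ≤ 2 * Real.pi

/-- The angle `ψ` relative to the beam orientation lies in the main lobe. -/
def SectorBeam.InMainLobe (s : SectorBeam) (ψ : ℝ) : Prop :=
  |wrapAngle ψ| ≤ s.width / 2

open Classical in
/-- The sectorized beam pattern. -/
def SectorBeam.gain (s : SectorBeam) (ψ : ℝ) : ℝ :=
  if s.InMainLobe ψ then s.a else s.b

/-- System parameters, in the frame in which the typical secondary receiver is the origin and
the typical secondary transmitter is `rs∠0`. -/
structure System where
  /-- path-loss exponent -/
  α : ℝ
  /-- transmit-restriction threshold -/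
  ρ : ℝ
  /-- SINR threshold -/
  τ : ℝ
  /-- transmit power of the secondary transmitters -/
  ps : ℝ
  /-- length of the secondary links -/
  rs : ℝ
  /-- length of the primary link -/
  rp : ℝ
  /-- distance of the primary transmitter -/
  xp : ℝ
  /-- angle of the primary transmitter -/
  δp : ℝ
  /-- orientation of the primary link, as seen from the primary transmitter -/
  ωp : ℝ
  α_pos : 0 < α
  ρ_pos : 0 < ρ
  τ_pos : 0 < τ
  ps_pos : 0 < ps
  rs_pos : 0 < rs
  rp_nonneg : 0 ≤ rp
  xp_nonneg : 0 ≤ xp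

namespace System

variable (S : System)

/-- Location `Y_p` of the primary receiver. -/
def Yp : ℂ := polarPoint S.xp S.δp + polarPoint S.rp S.ωp

/-- `z_s`: distance from the primary receiver to the secondary transmitter at `x∠θ`. -/
def zs (x θ : ℝ) : ℝ := ‖polarPoint x θ - S.Yp‖

/-- `β_s(x, θ) = ∠(x∠θ - Y_p)`. -/
def βs (x θ : ℝ) : ℝ := (polarPoint x θ - S.Yp).arg

/-- `δ_s(x, θ) = θ - β_s(x, θ)`. -/
def δs (x θ : ℝ) : ℝ := θ - S.βs x θ

end System

/-- The law of a link orientation: uniform on `[0, 2π)`. -/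
def orientationLaw : Measure ℝ := ProbabilityTheory.cond volume (Ico 0 (2 * Real.pi))

/-- `1 - exp(-t)` for `t ∈ [0, ∞]`, with `exp(-∞) = 0`. -/
def oneSubExpNeg (t : ℝ≥0∞) : ℝ≥0∞ := 1 - EReal.exp (-(t : EReal))

/-! The secondary coverage formula involves quotients by directional gains, which may vanish
(side lobes of an ideal beam); they are taken in `[0, ∞]`. -/

section General

variable (S : System) (gst gpr gsr : ℝ → ℝ)

/-- Serving power `A_0` of the typical secondary link. -/
def A0 : ℝ := S.ps * gsr 0 * gst 0 * S.rs ^ (-S.α)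

/-- `A_s(ω, β) = ρ / (p_s g_st(β - ω) g_pr(ω_p - β))`. -/
def As (ω β : ℝ) : ℝ≥0∞ :=
  ENNReal.ofReal S.ρ / ENNReal.ofReal (S.ps * gst (β - ω) * gpr (S.ωp - β))

/-- `C_s(ω, θ) = A_0 / (τ p_s g_st(θ - ω - π) g_sr(θ))`. -/
def Cs (ω θ : ℝ) : ℝ≥0∞ :=
  ENNReal.ofReal (A0 S gst gsr) /
    ENNReal.ofReal (S.τ * S.ps * gst (θ - ω - Real.pi) * gsr θ)

/-- The quotient `(1 - exp(-A_s z_s^α)) / (1 + C_s x^α)`. -/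
def coverageQuotient (x θ ω : ℝ) : ℝ≥0∞ :=
  oneSubExpNeg (As S gst gpr ω (S.βs x θ) * ENNReal.ofReal (S.zs x θ ^ S.α)) /
    (1 + Cs S gst gsr ω θ * ENNReal.ofReal (x ^ S.α))

/-- The integral in the exponent of the secondary coverage formula (without `λ_s`):
`∫_0^{2π} ∫_0^∞ E_ω[...] x dx dθ`. -/
def coverageIntegral : ℝ≥0∞ :=
  ∫⁻ θ in Ico 0 (2 * Real.pi), ∫⁻ x in Ioi (0 : ℝ),
    (∫⁻ ω, coverageQuotient S gst gpr gsr x θ ω ∂orientationLaw) * ENNReal.ofReal x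

/-- Term-4: `I = ∫_0^{2π} E_ω[∫_0^∞ ... x dx] dθ`. -/
def term4 : ℝ≥0∞ :=
  ∫⁻ θ in Ico 0 (2 * Real.pi), ∫⁻ ω, (∫⁻ x in Ioi (0 : ℝ),
    coverageQuotient S gst gpr gsr x θ ω * ENNReal.ofReal x) ∂orientationLaw

end General

/-! The four transmit-gain cases and the four receive-gain events. -/

/-- Case `i` of the transmit gains, when the primary receiver is seen at angle `ψ` and the
typical secondary receiver at angle `ψ'` from the beam orientation of the secondary transmitter:
main/main, main/side, side/main, side/side. -/
def txCase (st : SectorBeam) (i : Fin 4) (ψ ψ' : ℝ) : Prop :=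
  ![st.InMainLobe ψ ∧ st.InMainLobe ψ', st.InMainLobe ψ ∧ ¬ st.InMainLobe ψ',
    ¬ st.InMainLobe ψ ∧ st.InMainLobe ψ', ¬ st.InMainLobe ψ ∧ ¬ st.InMainLobe ψ'] i

/-- `q_i(δ)`: probability of transmit-gain case `i` under a uniform orientation when the angles
`θ_s` and `β_s` differ by `δ` (evaluated at `β_s = 0`, `θ_s = δ`). -/
def txProb (st : SectorBeam) (i : Fin 4) (δ : ℝ) : ℝ≥0∞ :=
  orientationLaw {ω | txCase st i (0 - ω) (δ - ω - Real.pi)}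

/-- `𝒜_i`: transmit gain towards the primary receiver. -/
def gainA (st : SectorBeam) : Fin 4 → ℝ := ![st.a, st.a, st.b, st.b]

/-- `ℬ_i`: transmit gain towards the typical secondary receiver. -/
def gainB (st : SectorBeam) : Fin 4 → ℝ := ![st.a, st.b, st.a, st.b]

/-- `𝒞_k`: gain of the primary receiver. -/
def gainC (pr : SectorBeam) : Fin 4 → ℝ := ![pr.a, pr.a, pr.b, pr.b]

/-- `𝒟_k`: gain of the typical secondary receiver. -/
def gainD (sr : SectorBeam) : Fin 4 → ℝ := ![sr.a, sr.b, sr.a, sr.b]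

/-- The interfering transmitter at `x∠θ` is seen inside the primary receiver's main beam. -/
def primaryEvent (S : System) (pr : SectorBeam) (x : ℝ) : Set ℝ :=
  {θ | wrapAngle (S.βs x θ - S.ωp) ∈ Ioo (-(pr.width / 2)) (pr.width / 2)}

/-- The interfering transmitter at angle `θ` is seen inside the typical secondary receiver's main
beam. -/
def secondaryEvent (sr : SectorBeam) : Set ℝ :=
  {θ | wrapAngle θ ∈ Ioo (-(sr.width / 2)) (sr.width / 2)}

/-- `ℱ_k` at distance `x`, as a set of angles `θ ∈ [0, 2π)`. -/
def rxEvent (S : System) (pr sr : SectorBeam) (x : ℝ) (k : Fin 4) : Set ℝ :=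
  Ico 0 (2 * Real.pi) ∩
    ![primaryEvent S pr x ∩ secondaryEvent sr, primaryEvent S pr x ∩ (secondaryEvent sr)ᶜ,
      (primaryEvent S pr x)ᶜ ∩ secondaryEvent sr,
      (primaryEvent S pr x)ᶜ ∩ (secondaryEvent sr)ᶜ] k

/-- The summand
`(1 - exp(-ρ z^α / (p_s 𝒜_i 𝒞_k))) / (1 + (1/τ) (x/r_s)^α a_st a_sr / (ℬ_i 𝒟_k))`. -/
def sectorSummand (S : System) (st pr sr : SectorBeam) (i k : Fin 4) (x θ : ℝ) : ℝ≥0∞ :=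
  oneSubExpNeg (ENNReal.ofReal (S.ρ * S.zs x θ ^ S.α) /
      ENNReal.ofReal (S.ps * gainA st i * gainC pr k)) /
    (1 + ENNReal.ofReal (1 / S.τ * (x / S.rs) ^ S.α * (st.a * sr.a)) /
      ENNReal.ofReal (gainB st i * gainD sr k))

end CogCoverage

end

namespace CogCoverage

theorem wrapAngle_eq_arg (ψ : ℝ) :
    wrapAngle ψ = (Complex.exp ((ψ : ℂ) * Complex.I)).arg := by
  rw [Complex.arg_exp_mul_I]; rfl

@[fun_prop]
theorem measurable_wrapAngle : Measurable wrapAngle := by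
  rw [funext wrapAngle_eq_arg]
  fun_prop

@[fun_prop]
theorem measurable_oneSubExpNeg : Measurable oneSubExpNeg := by
  unfold oneSubExpNeg
  fun_prop

@[fun_prop]
theorem measurable_polarPoint : Measurable fun p : ℝ × ℝ => polarPoint p.1 p.2 := by
  unfold polarPoint
  fun_prop

theorem SectorBeam.measurableSet_inMainLobe (s : SectorBeam) :
    MeasurableSet {ψ | s.InMainLobe ψ} := by
  unfold SectorBeam.InMainLobe
  exact measurableSet_le (by fun_prop) (by fun_prop)

@[fun_prop]
theorem SectorBeam.measurable_gain (s : SectorBeam) : Measurable s.gain := by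
  unfold SectorBeam.gain
  exact Measurable.ite s.measurableSet_inMainLobe measurable_const measurable_const

@[fun_prop]
theorem System.measurable_βs (S : System) : Measurable fun p : ℝ × ℝ => S.βs p.1 p.2 := by
  unfold System.βs
  fun_prop

@[fun_prop]
theorem System.measurable_zs (S : System) : Measurable fun p : ℝ × ℝ => S.zs p.1 p.2 := by
  unfold System.zs
  fun_prop

theorem measurable_coverageQuotient (S : System) (st pr sr : SectorBeam) :
    Measurable fun p : (ℝ × ℝ) × ℝ =>
      coverageQuotient S st.gain pr.gain sr.gain p.1.1 p.1.2 p.2 := by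
  have h1 := S.measurable_βs.comp (measurable_fst : Measurable fun p : (ℝ × ℝ) × ℝ => p.1)
  have h2 := S.measurable_zs.comp (measurable_fst : Measurable fun p : (ℝ × ℝ) × ℝ => p.1)
  simp only [Function.comp_def] at h1 h2
  unfold coverageQuotient As Cs A0
  fun_prop

theorem countable_setOf_sin_eq (k : ℝ) : {θ : ℝ | Real.sin θ = k}.Countable := by
  by_cases h : ∃ t, Real.sin t = k
  · obtain ⟨t, rfl⟩ := h
    refine ((countable_range fun m : ℤ => 2 * m * Real.pi + t).union
      (countable_range fun m : ℤ => (2 * m + 1) * Real.pi - t)).mono ?_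
    intro θ hθ
    obtain ⟨m, hm | hm⟩ := Real.sin_eq_sin_iff.1 (show Real.sin t = Real.sin θ from hθ.symm)
    · exact Or.inl ⟨m, hm.symm⟩
    · exact Or.inr ⟨m, hm.symm⟩
  · convert countable_empty
    ext θ
    exact ⟨fun hθ => h ⟨θ, hθ⟩, False.elim⟩

theorem countable_setOf_wrapAngle_sub_eq (a c : ℝ) : {θ : ℝ | wrapAngle (θ - a) = c}.Countable := by
  refine ((countable_setOf_sin_eq (Real.sin c)).preimage (sub_left_injective (b := a))).mono ?_
  intro θ hθ
  have h : ((θ - a : ℝ) : Real.Angle) = (c : Real.Angle) := by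
    rw [← Real.Angle.coe_toReal ((θ - a : ℝ) : Real.Angle)]
    exact congrArg _ hθ
  simpa [-Real.Angle.coe_sub] using congrArg Real.Angle.sin h

/-- A ray from the primary receiver meets a circle about the origin in a countable set of angles. -/
theorem System.countable_setOf_wrapAngle_βs_eq (S : System) {x : ℝ} (hx : 0 < x) (a c : ℝ) :
    {θ : ℝ | wrapAngle (S.βs x θ - a) = c}.Countable := by
  refine ((countable_setOf_sin_eq
    ((S.Yp * Complex.exp (((-(c + a) : ℝ) : ℂ) * Complex.I)).im / x)).preimage
      (sub_left_injective (b := c + a))).mono ?_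
  intro θ hθ
  have h : (S.βs x θ : Real.Angle) = ((c + a : ℝ) : Real.Angle) := by
    have : ((S.βs x θ - a : ℝ) : Real.Angle) = (c : Real.Angle) := by
      rw [← Real.Angle.coe_toReal ((S.βs x θ - a : ℝ) : Real.Angle)]
      exact congrArg _ hθ
    rw [Real.Angle.coe_add, ← this, ← Real.Angle.coe_add, sub_add_cancel]
  have hs : Real.sin (S.βs x θ - (c + a)) = 0 := by
    have := congrArg (fun t : Real.Angle => (t - ((c + a : ℝ) : Real.Angle)).sin) h
    simpa [-Real.Angle.coe_add, ← Real.Angle.coe_sub] using this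
  have hw := Complex.norm_mul_exp_arg_mul_I (polarPoint x θ - S.Yp)
  have h1 : (polarPoint x θ - S.Yp) * Complex.exp (((-(c + a) : ℝ) : ℂ) * Complex.I) =
      ((‖polarPoint x θ - S.Yp‖ : ℝ) : ℂ) *
        Complex.exp (((S.βs x θ - (c + a) : ℝ) : ℂ) * Complex.I) := by
    nth_rw 1 [← hw]
    rw [mul_assoc, ← Complex.exp_add, System.βs]
    push_cast
    ring_nf
  have h2 : polarPoint x θ * Complex.exp (((-(c + a) : ℝ) : ℂ) * Complex.I) =
      (x : ℂ) * Complex.exp (((θ - (c + a) : ℝ) : ℂ) * Complex.I) := by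
    rw [polarPoint, mul_assoc, ← Complex.exp_add]
    push_cast
    ring_nf
  have h3 := congrArg Complex.im h1
  rw [sub_mul, h2, Complex.sub_im, Complex.im_ofReal_mul, Complex.im_ofReal_mul,
    Complex.exp_ofReal_mul_I_im, Complex.exp_ofReal_mul_I_im, hs, mul_zero, sub_eq_zero] at h3
  simp only [mem_preimage, mem_ofPred_eq]
  rw [eq_div_iff hx.ne', mul_comm, h3]

theorem SectorBeam.inMainLobe_congr (s : SectorBeam) {a b : ℝ}
    (h : (a : Real.Angle) = (b : Real.Angle)) : s.InMainLobe a ↔ s.InMainLobe b := by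
  simp only [SectorBeam.InMainLobe, wrapAngle, h]

theorem txCase_congr (st : SectorBeam) (i : Fin 4) {a b a' b' : ℝ}
    (h : (a : Real.Angle) = (b : Real.Angle)) (h' : (a' : Real.Angle) = (b' : Real.Angle)) :
    txCase st i a a' ↔ txCase st i b b' := by
  simp only [txCase, st.inMainLobe_congr h, st.inMainLobe_congr h']

theorem measurableSet_setOf_txCase (st : SectorBeam) (i : Fin 4) (β γ : ℝ) :
    MeasurableSet {ω | txCase st i (β - ω) (γ - ω)} := by
  have h (b : ℝ) : MeasurableSet {ω | st.InMainLobe (b - ω)} :=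
    st.measurableSet_inMainLobe.preimage (by fun_prop : Measurable fun ω : ℝ => b - ω)
  fin_cases i
  · exact (h β).inter (h γ)
  · exact (h β).inter (h γ).compl
  · exact (h β).compl.inter (h γ)
  · exact (h β).compl.inter (h γ).compl

instance : IsProbabilityMeasure orientationLaw :=
  ProbabilityTheory.cond_isProbabilityMeasure_of_finite
    (by simp [Real.volume_Ico, Real.pi_pos]) measure_Ico_lt_top.ne

/-- Volume of one period of a `2π`-periodic set, over shifted periods. -/
theorem volume_Ico_inter_preimage_add {A : Set ℝ} (hA : MeasurableSet A)
    (hper : ∀ m : ℤ, ∀ ω, m • (2 * Real.pi) + ω ∈ A ↔ ω ∈ A) (c : ℝ) :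
    volume (Ico 0 (2 * Real.pi) ∩ (fun ω => ω + c) ⁻¹' A) =
      volume (Ico 0 (2 * Real.pi) ∩ A) := by
  have h2 := Real.two_pi_pos
  have key := (isAddFundamentalDomain_Ioc h2 c volume).measure_set_eq
    (isAddFundamentalDomain_Ioc h2 0 volume) hA (by
      rintro ⟨g, m, rfl⟩
      ext ω
      exact hper m ω)
  have e : Ioc 0 (2 * Real.pi) ∩ (fun ω => ω + c) ⁻¹' A =
      (fun ω => ω + c) ⁻¹' (A ∩ Ioc c (c + 2 * Real.pi)) := by
    ext ω
    simp only [mem_inter_iff, mem_Ioc, mem_preimage]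
    constructor
    · rintro ⟨⟨h, h'⟩, h''⟩
      exact ⟨h'', by linarith, by linarith⟩
    · rintro ⟨h'', h, h'⟩
      exact ⟨⟨by linarith, by linarith⟩, h''⟩
  have ae (B : Set ℝ) : volume (Ico 0 (2 * Real.pi) ∩ B) = volume (Ioc 0 (2 * Real.pi) ∩ B) :=
    measure_congr (Ico_ae_eq_Ioc.inter (ae_eq_refl B))
  rw [ae, ae, e, measure_preimage_add_right, key, zero_add, inter_comm]

theorem orientationLaw_txCase (st : SectorBeam) (i : Fin 4) (β θ : ℝ) :
    orientationLaw {ω | txCase st i (β - ω) (θ - ω - Real.pi)} = txProb st i (θ - β) := by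
  have e (b t : ℝ) : {ω | txCase st i (b - ω) (t - ω - Real.pi)} =
      {ω | txCase st i (b - ω) (t - Real.pi - ω)} := by
    simp only [sub_right_comm]
  have hm := measurableSet_setOf_txCase st i β (θ - Real.pi)
  have key := volume_Ico_inter_preimage_add hm (by
    intro m ω
    have h2 (b : ℝ) : ((b - (m • (2 * Real.pi) + ω) : ℝ) : Real.Angle) = ((b - ω : ℝ)) := by
      simp
    exact txCase_congr st i (h2 _) (h2 _)) β
  rw [txProb, e, e, orientationLaw, ProbabilityTheory.cond_apply measurableSet_Ico,
    ProbabilityTheory.cond_apply measurableSet_Ico, ← key]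
  congr 4
  ext ω
  simp only [mem_preimage, mem_ofPred_eq]
  rw [show β - (ω + β) = 0 - ω by ring,
    show θ - Real.pi - (ω + β) = θ - β - Real.pi - ω by ring]


theorem coverageIntegral_eq_term4 (S : System) (st pr sr : SectorBeam) :
    coverageIntegral S st.gain pr.gain sr.gain = term4 S st.gain pr.gain sr.gain := by
  unfold coverageIntegral term4
  refine lintegral_congr fun θ => ?_
  have hm : Measurable fun p : ℝ × ℝ =>
      coverageQuotient S st.gain pr.gain sr.gain p.1 θ p.2 * ENNReal.ofReal p.1 :=
    ((measurable_coverageQuotient S st pr sr).comp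
      (by fun_prop : Measurable fun p : ℝ × ℝ => ((p.1, θ), p.2))).mul (by fun_prop)
  rw [← lintegral_lintegral_swap hm.aemeasurable]
  refine lintegral_congr fun x => ?_
  exact (lintegral_mul_const' _ _ ENNReal.ofReal_ne_top).symm

theorem coverageIntegral_eq_lintegral_radius (S : System) (st pr sr : SectorBeam) :
    coverageIntegral S st.gain pr.gain sr.gain =
      ∫⁻ x in Ioi (0 : ℝ), ∫⁻ θ in Ico 0 (2 * Real.pi),
        (∫⁻ ω, coverageQuotient S st.gain pr.gain sr.gain x θ ω ∂orientationLaw) *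
          ENNReal.ofReal x := by
  refine lintegral_lintegral_swap (Measurable.aemeasurable ?_)
  have h : Measurable fun p : ℝ × ℝ =>
      ∫⁻ ω, coverageQuotient S st.gain pr.gain sr.gain p.1 p.2 ω ∂orientationLaw :=
    (measurable_coverageQuotient S st pr sr).lintegral_prod_right'
  exact (h.comp measurable_swap).mul (by fun_prop)

theorem measurableSet_primaryEvent (S : System) (pr : SectorBeam) (x : ℝ) :
    MeasurableSet (primaryEvent S pr x) := by
  have h : Measurable fun θ => wrapAngle (S.βs x θ - S.ωp) :=
    measurable_wrapAngle.comp
      ((S.measurable_βs.comp (by fun_prop : Measurable fun θ : ℝ => (x, θ))).sub_const _)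
  exact measurableSet_Ioo.preimage h

theorem measurableSet_secondaryEvent (sr : SectorBeam) : MeasurableSet (secondaryEvent sr) :=
  measurableSet_Ioo.preimage measurable_wrapAngle

theorem measurableSet_rxEvent (S : System) (pr sr : SectorBeam) (x : ℝ) (k : Fin 4) :
    MeasurableSet (rxEvent S pr sr x k) := by
  have h1 := measurableSet_primaryEvent S pr x
  have h2 := measurableSet_secondaryEvent sr
  refine measurableSet_Ico.inter ?_
  fin_cases k
  · exact h1.inter h2
  · exact h1.inter h2.compl
  · exact h1.compl.inter h2
  · exact h1.compl.inter h2.compl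

theorem iUnion_rxEvent (S : System) (pr sr : SectorBeam) (x : ℝ) :
    ⋃ k, rxEvent S pr sr x k = Ico 0 (2 * Real.pi) := by
  ext θ
  simp only [mem_iUnion, Fin.exists_fin_succ, rxEvent]
  by_cases h1 : θ ∈ primaryEvent S pr x <;> by_cases h2 : θ ∈ secondaryEvent sr <;>
    simp [h1, h2]

theorem pairwise_disjoint_rxEvent (S : System) (pr sr : SectorBeam) (x : ℝ) :
    Pairwise (Function.onFun Disjoint (rxEvent S pr sr x)) := by
  intro k l hkl
  refine disjoint_left.2 fun θ hk hl => hkl ?_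
  have hk := hk.2
  have hl := hl.2
  by_cases h1 : θ ∈ primaryEvent S pr x <;> by_cases h2 : θ ∈ secondaryEvent sr <;>
    fin_cases k <;> fin_cases l <;> simp_all

theorem setLIntegral_eq_sum_rxEvent (S : System) (pr sr : SectorBeam) (x : ℝ) (f : ℝ → ℝ≥0∞) :
    ∫⁻ θ in Ico 0 (2 * Real.pi), f θ = ∑ k, ∫⁻ θ in rxEvent S pr sr x k, f θ := by
  rw [← iUnion_rxEvent S pr sr x, lintegral_iUnion (measurableSet_rxEvent S pr sr x)
    (pairwise_disjoint_rxEvent S pr sr x), tsum_fintype]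

theorem SectorBeam.inMainLobe_neg (s : SectorBeam) (ψ : ℝ) :
    s.InMainLobe (-ψ) ↔ s.InMainLobe ψ := by
  simp only [SectorBeam.InMainLobe, wrapAngle, Real.Angle.coe_neg, Real.Angle.abs_toReal_neg]

theorem SectorBeam.gain_neg (s : SectorBeam) (ψ : ℝ) : s.gain (-ψ) = s.gain ψ := by
  classical
  exact if_congr (s.inMainLobe_neg ψ) rfl rfl

theorem SectorBeam.gain_zero (s : SectorBeam) : s.gain 0 = s.a := by
  refine if_pos ?_
  simpa [SectorBeam.InMainLobe, wrapAngle] using div_nonneg s.width_nonneg zero_le_two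

/-- Off the edges of the beam, the closed main lobe and its interior agree. -/
theorem SectorBeam.inMainLobe_iff_mem_Ioo (s : SectorBeam) {ψ : ℝ}
    (h : wrapAngle ψ ≠ s.width / 2) (h' : wrapAngle ψ ≠ -(s.width / 2)) :
    s.InMainLobe ψ ↔ wrapAngle ψ ∈ Ioo (-(s.width / 2)) (s.width / 2) := by
  rw [SectorBeam.InMainLobe, abs_le, mem_Ioo, h'.symm.le_iff_lt, h.le_iff_lt]

theorem gain_eq_of_mem_rxEvent {S : System} {pr sr : SectorBeam} {x θ : ℝ} {k : Fin 4}
    (h : θ ∈ rxEvent S pr sr x k)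
    (h1 : wrapAngle (S.βs x θ - S.ωp) ≠ pr.width / 2)
    (h2 : wrapAngle (S.βs x θ - S.ωp) ≠ -(pr.width / 2))
    (h3 : wrapAngle θ ≠ sr.width / 2) (h4 : wrapAngle θ ≠ -(sr.width / 2)) :
    pr.gain (S.ωp - S.βs x θ) = gainC pr k ∧ sr.gain θ = gainD sr k := by
  have hp := pr.inMainLobe_iff_mem_Ioo h1 h2
  have hs := sr.inMainLobe_iff_mem_Ioo h3 h4
  rw [← neg_sub, pr.gain_neg]
  have h := h.2
  simp only [SectorBeam.gain, hp, hs]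
  fin_cases k
  · exact ⟨if_pos h.1, if_pos h.2⟩
  · exact ⟨if_pos h.1, if_neg h.2⟩
  · exact ⟨if_neg h.1, if_pos h.2⟩
  · exact ⟨if_neg h.1, if_neg h.2⟩

theorem gain_eq_of_txCase {st : SectorBeam} {i : Fin 4} {ψ ψ' : ℝ} (h : txCase st i ψ ψ') :
    st.gain ψ = gainA st i ∧ st.gain ψ' = gainB st i := by
  fin_cases i
  · exact ⟨if_pos h.1, if_pos h.2⟩
  · exact ⟨if_pos h.1, if_neg h.2⟩
  · exact ⟨if_neg h.1, if_pos h.2⟩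
  · exact ⟨if_neg h.1, if_neg h.2⟩

theorem existsUnique_txCase (st : SectorBeam) (ψ ψ' : ℝ) : ∃! i, txCase st i ψ ψ' := by
  simp only [ExistsUnique, Fin.exists_fin_succ, Fin.forall_fin_succ, txCase]
  by_cases h : st.InMainLobe ψ <;> by_cases h' : st.InMainLobe ψ' <;> simp [h, h']

theorem gainB_nonneg (st : SectorBeam) (i : Fin 4) : 0 ≤ gainB st i := by
  have := st.a_pos.le
  have := st.b_nonneg
  fin_cases i <;> assumption

theorem gainD_nonneg (sr : SectorBeam) (k : Fin 4) : 0 ≤ gainD sr k :=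
  gainB_nonneg sr k

theorem A0_pos (S : System) (st sr : SectorBeam) : 0 < A0 S st.gain sr.gain := by
  have := S.ps_pos
  have := S.rs_pos
  have := st.a_pos
  have := sr.a_pos
  rw [A0, st.gain_zero, sr.gain_zero]
  positivity

theorem coverageQuotient_eq_sectorSummand {S : System} {st pr sr : SectorBeam} {i k : Fin 4}
    {x θ ω : ℝ} (hx : 0 < x) (hA : st.gain (S.βs x θ - ω) = gainA st i)
    (hB : st.gain (θ - ω - Real.pi) = gainB st i)
    (hC : pr.gain (S.ωp - S.βs x θ) = gainC pr k) (hD : sr.gain θ = gainD sr k) :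
    coverageQuotient S st.gain pr.gain sr.gain x θ ω = sectorSummand S st pr sr i k x θ := by
  have hps := S.ps_pos
  have hrs := S.rs_pos
  have hτ := S.τ_pos
  have hst := st.a_pos
  have hsr := sr.a_pos
  have h1 : As S st.gain pr.gain ω (S.βs x θ) * ENNReal.ofReal (S.zs x θ ^ S.α) =
      ENNReal.ofReal (S.ρ * S.zs x θ ^ S.α) /
        ENNReal.ofReal (S.ps * gainA st i * gainC pr k) := by
    rw [As, hA, hC, ENNReal.ofReal_mul S.ρ_pos.le, ENNReal.mul_div_right_comm]
  have h2 : Cs S st.gain sr.gain ω θ * ENNReal.ofReal (x ^ S.α) =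
      ENNReal.ofReal (1 / S.τ * (x / S.rs) ^ S.α * (st.a * sr.a)) /
        ENNReal.ofReal (gainB st i * gainD sr k) := by
    have hA0 := A0_pos S st sr
    rw [Cs, hB, hD, ← ENNReal.mul_div_right_comm, ← ENNReal.ofReal_mul hA0.le]
    rcases (mul_nonneg (gainB_nonneg st i) (gainD_nonneg sr k)).eq_or_lt with h0 | h0
    · rw [mul_assoc (S.τ * S.ps), ← h0, mul_zero, ENNReal.ofReal_zero,
        ENNReal.div_zero (ENNReal.ofReal_pos.2 (by positivity)).ne',
        ENNReal.div_zero (ENNReal.ofReal_pos.2 (by positivity)).ne']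
    · rw [mul_assoc (S.τ * S.ps), ← ENNReal.ofReal_div_of_pos h0,
        ← ENNReal.ofReal_div_of_pos (by positivity), A0, st.gain_zero, sr.gain_zero,
        Real.div_rpow hx.le hrs.le, Real.rpow_neg hrs.le]
      congr 1
      field_simp
  rw [coverageQuotient, sectorSummand, h1, h2]

theorem lintegral_coverageQuotient {S : System} {st pr sr : SectorBeam} {k : Fin 4} {x θ : ℝ}
    (hx : 0 < x) (hC : pr.gain (S.ωp - S.βs x θ) = gainC pr k) (hD : sr.gain θ = gainD sr k) :
    ∫⁻ ω, coverageQuotient S st.gain pr.gain sr.gain x θ ω ∂orientationLaw =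
      ∑ i, txProb st i (S.δs x θ) * sectorSummand S st pr sr i k x θ := by
  set E : Fin 4 → Set ℝ := fun i => {ω | txCase st i (S.βs x θ - ω) (θ - ω - Real.pi)} with hE
  have hm (i : Fin 4) : MeasurableSet (E i) := by
    have h := measurableSet_setOf_txCase st i (S.βs x θ) (θ - Real.pi)
    simpa only [hE, sub_right_comm θ Real.pi] using h
  have hU : ⋃ i, E i = univ := eq_univ_of_forall fun ω =>
    mem_iUnion.2 (existsUnique_txCase st _ _).exists
  have hd : Pairwise (Function.onFun Disjoint E) := fun i j hij =>
    disjoint_left.2 fun ω hi hj => hij ((existsUnique_txCase st _ _).unique hi hj)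
  rw [← setLIntegral_univ, ← hU, lintegral_iUnion hm hd, tsum_fintype]
  refine Finset.sum_congr rfl fun i _ => ?_
  rw [setLIntegral_congr_fun (g := fun _ => sectorSummand S st pr sr i k x θ) (hm i)
    fun ω hω => coverageQuotient_eq_sectorSummand hx (gain_eq_of_txCase hω).1
      (gain_eq_of_txCase hω).2 hC hD, setLIntegral_const, mul_comm, System.δs,
    ← orientationLaw_txCase]

theorem coverageIntegral_eq_sector_sum (S : System) (st pr sr : SectorBeam) :
    coverageIntegral S st.gain pr.gain sr.gain =
      ∫⁻ x in Ioi (0 : ℝ), ∑ k : Fin 4, ∫⁻ θ in rxEvent S pr sr x k,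
        ∑ i : Fin 4, txProb st i (S.δs x θ) * sectorSummand S st pr sr i k x θ *
          ENNReal.ofReal x := by
  rw [coverageIntegral_eq_lintegral_radius]
  refine setLIntegral_congr_fun measurableSet_Ioi fun x (hx : 0 < x) => ?_
  rw [setLIntegral_eq_sum_rxEvent S pr sr x]
  refine Finset.sum_congr rfl fun k _ => ?_
  refine setLIntegral_congr_fun_ae (measurableSet_rxEvent S pr sr x k) ?_
  have hsr (c : ℝ) : {θ : ℝ | wrapAngle θ = c}.Countable := by
    simpa using countable_setOf_wrapAngle_sub_eq 0 c
  filter_upwards [(S.countable_setOf_wrapAngle_βs_eq hx S.ωp (pr.width / 2)).ae_notMem volume,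
    (S.countable_setOf_wrapAngle_βs_eq hx S.ωp (-(pr.width / 2))).ae_notMem volume,
    (hsr (sr.width / 2)).ae_notMem volume, (hsr (-(sr.width / 2))).ae_notMem volume]
    with θ h1 h2 h3 h4 hθ
  obtain ⟨hC, hD⟩ := gain_eq_of_mem_rxEvent hθ h1 h2 h3 h4
  rw [lintegral_coverageQuotient hx hC hD, Finset.sum_mul]

theorem SectorBeam.gain_nonneg (s : SectorBeam) (ψ : ℝ) : 0 ≤ s.gain ψ := by
  unfold SectorBeam.gain
  split_ifs
  exacts [s.a_pos.le, s.b_nonneg]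

theorem SectorBeam.gain_le (s : SectorBeam) (ψ : ℝ) : s.gain ψ ≤ max s.a s.b := by
  unfold SectorBeam.gain
  split_ifs
  exacts [le_max_left _ _, le_max_right _ _]

theorem exists_coverageQuotient_le (S : System) (st pr sr : SectorBeam) :
    ∃ c : ℝ, 0 < c ∧ ∀ x θ ω, coverageQuotient S st.gain pr.gain sr.gain x θ ω ≤
      (1 + ENNReal.ofReal (c * x ^ S.α))⁻¹ := by
  have hps := S.ps_pos
  have hτ := S.τ_pos
  have hst : 0 < max st.a st.b := lt_max_of_lt_left st.a_pos
  have hsr : 0 < max sr.a sr.b := lt_max_of_lt_left sr.a_pos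
  have hA0 := A0_pos S st sr
  have hc : 0 < A0 S st.gain sr.gain / (S.τ * S.ps * max st.a st.b * max sr.a sr.b) := by
    positivity
  refine ⟨_, hc, fun x θ ω => ?_⟩
  rw [coverageQuotient, div_eq_mul_inv, ENNReal.ofReal_mul hc.le,
    ENNReal.ofReal_div_of_pos (by positivity)]
  refine (mul_le_of_le_one_left' tsub_le_self).trans (ENNReal.inv_le_inv.2 ?_)
  rw [Cs]
  gcongr
  · exact sr.gain_nonneg _
  · exact st.gain_le _
  · exact sr.gain_le _

theorem lintegral_inv_one_add_rpow_lt_top {α c : ℝ} (hα : 2 < α) (hc : 0 < c) :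
    ∫⁻ x in Ioi (0 : ℝ), (1 + ENNReal.ofReal (c * x ^ α))⁻¹ * ENNReal.ofReal x < ⊤ := by
  rw [← Ioc_union_Ioi_eq_Ioi zero_le_one]
  refine (lintegral_union_le _ _ _).trans_lt (ENNReal.add_lt_top.2 ⟨?_, ?_⟩)
  · refine (setLIntegral_mono (g := fun _ => 1) measurable_const fun x hx => ?_).trans_lt ?_
    · exact mul_le_one' (ENNReal.inv_le_one.2 le_self_add) (ENNReal.ofReal_le_one.2 hx.2)
    · simp
  · have hint := (integrableOn_Ioi_rpow_of_lt (a := 1 - α) (by linarith) one_pos).const_mul c⁻¹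
    refine (setLIntegral_mono (g := fun x => ENNReal.ofReal (c⁻¹ * x ^ (1 - α))) (by fun_prop)
      fun x (hx : 1 < x) => ?_).trans_lt hint.lintegral_lt_top
    have hx0 : 0 < x := by linarith
    have hp : 0 < c * x ^ α := by positivity
    calc (1 + ENNReal.ofReal (c * x ^ α))⁻¹ * ENNReal.ofReal x
        ≤ (ENNReal.ofReal (c * x ^ α))⁻¹ * ENNReal.ofReal x := by
          gcongr
          exact le_add_self
      _ = ENNReal.ofReal (c⁻¹ * x ^ (1 - α)) := by
          rw [← ENNReal.ofReal_inv_of_pos hp, ← ENNReal.ofReal_mul (by positivity),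
            Real.rpow_sub hx0, Real.rpow_one]
          congr 1
          field_simp

theorem term4_lt_top (S : System) (st pr sr : SectorBeam) (hα : 2 < S.α) :
    term4 S st.gain pr.gain sr.gain < ⊤ := by
  obtain ⟨c, hc, hle⟩ := exists_coverageQuotient_le S st pr sr
  calc term4 S st.gain pr.gain sr.gain
      ≤ ∫⁻ _ in Ico 0 (2 * Real.pi), ∫⁻ _, (∫⁻ x in Ioi (0 : ℝ),
          (1 + ENNReal.ofReal (c * x ^ S.α))⁻¹ * ENNReal.ofReal x) ∂orientationLaw := by
        unfold term4
        gcongr with θ ω x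
        exact hle x θ ω
    _ < ⊤ := by
        rw [setLIntegral_const, lintegral_const, measure_univ, mul_one]
        exact ENNReal.mul_lt_top (lintegral_inv_one_add_rpow_lt_top hα hc) measure_Ico_lt_top

end CogCoverage

theorem mainTheorem8 (S : CogCoverage.System) (st pr sr : CogCoverage.SectorBeam) :
    (∀ (i : Fin 4) (β θ : ℝ),
      CogCoverage.orientationLaw
          {ω | CogCoverage.txCase st i (β - ω) (θ - ω - Real.pi)} =
        CogCoverage.txProb st i (θ - β)) ∧
    CogCoverage.coverageIntegral S st.gain pr.gain sr.gain =
      CogCoverage.term4 S st.gain pr.gain sr.gain ∧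
    CogCoverage.term4 S st.gain pr.gain sr.gain =
      (∫⁻ x in Set.Ioi (0 : ℝ), ∑ k : Fin 4,
        ∫⁻ θ in CogCoverage.rxEvent S pr sr x k,
          ∑ i : Fin 4, CogCoverage.txProb st i (S.δs x θ) *
            CogCoverage.sectorSummand S st pr sr i k x θ * ENNReal.ofReal x) ∧
    (2 < S.α → CogCoverage.term4 S st.gain pr.gain sr.gain < ⊤) :=
  ⟨CogCoverage.orientationLaw_txCase st, CogCoverage.coverageIntegral_eq_term4 S st pr sr,
    (CogCoverage.coverageIntegral_eq_term4 S st pr sr).symm.trans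
      (CogCoverage.coverageIntegral_eq_sector_sum S st pr sr),
    CogCoverage.term4_lt_top S st pr sr⟩
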